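/- Consider a downlink with an $N$-antenna base station and a single-antenna terminal. The channel is $\mathbf h\sim\mathcal{CN}(\mathbf 0,\mathbf R)$ on $\mathbb C^N$ with $\mathbf R$ positive semidefinite, and the base station knows an estimate $\hat{\mathbf h}\in\mathbb C^N$, an arbitrary random vector defined jointly with $\mathbf h$. Fix $p^{\mathrm{BS}}>0$, $\sigma_{\mathrm{UT}}^2>0$ and $\kappa_t^{\mathrm{BS}},\kappa_r^{\mathrm{UT}}\ge 0$. When a beamforming vector $\mathbf w=\mathbf w(\hat{\mathbf h})$ with $\|\mathbf w\|=1$ and a data signal $s$ are used, the terminal receives $$y=\mathbf h^T(\mathbf w s+\boldsymbol\eta_t)+n+\eta_r ,$$ where $n\sim\mathcal{CN}(0,\sigma_{\mathrm{UT}}^2)$ and, for given $\mathbf h$ and $\hat{\mathbf h}$, $\boldsymbol\eta_t\sim\mathcal{CN}(\mathbf 0,\kappa_t^{\mathrm{BS}}p^{\mathrm{BS}}\operatorname{diag}(|w_1|^2,\dots,|w_N|^2))$ and $\eta_r\sim\mathcal{CN}(0,\kappa_r^{\mathrm{UT}}p^{\mathrm{BS}}|\mathbf h^T\mathbf w|^2)$;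 $n$, $\boldsymbol\eta_t$, $\eta_r$ and $s$ are independent of each other and of the terminal's channel knowledge. The terminal knows a variable $U=g(\hat{\mathbf h})$, which the base station then knows too, and any further side information $Z$, with values in a standard Borel space, defined jointly with $(\mathbf h,\hat{\mathbf h})$; $g$ is any measurable function. This covers everything from no channel knowledge ($U,Z$ constant) to perfect knowledge ($U=\hat{\mathbf h}$, $Z=\mathbf h$). The capacity, in bits per channel use, is $$\mathtt C=\mathbb E_U\Big\{\sup_{\mathbf w(\cdot):\,\|\mathbf w\|=1}\ \sup_{f(s):\,\mathbb E|s|^2\le p^{\mathrm{BS}}}\ \mathbb E_Z\{\mathcal I(s;y\mid U,Z)\}\Big\},$$ where the suprema are over measurable functions $\mathbf w$ of $\hat{\mathbf h}$ and over probability laws $f$ of $s$ (both may depend on the value of $U$), $\mathcal I(s;y\mid U,Z)$ is the mutual information of $s$ and $y$ under their joint law given the values of $U$ and $Z$, and $\mathbb E_Z$ is the conditional expectation over $Z$ given $U$. Then, for every such channel knowledge of the terminal and every measurable function $\mathbf v=\mathbf v(\hat{\mathbf h})$ with $\|\mathbf v\|=1$ almost surely, $$\mathtt C\ \ge\ \log_2\big(1+\widetilde{\mathtt{SINR}}\big),\qquad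 \widetilde{\mathtt{SINR}}=\frac{\big|\mathbb E\{\mathbf h^T\mathbf v\}\big|^2}{(1+\kappa_r^{\mathrm{UT}})\,\mathbb E\{|\mathbf h^T\mathbf v|^2\}-\big|\mathbb E\{\mathbf h^T\mathbf v\}\big|^2+\kappa_t^{\mathrm{BS}}\sum_{i=1}^N\mathbb E\{|h_i|^2|v_i|^2\}+\dfrac{\sigma_{\mathrm{UT}}^2}{p^{\mathrm{BS}}}} .$$ -/

import Mathlib

open MeasureTheory ProbabilityTheory InformationTheory
open scoped ENNReal NNReal ComplexOrder

namespace MISO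

/-- The circularly-symmetric complex Gaussian law `CN(0, v)` on `ℂ`: independent real and
imaginary parts, each `N(0, v/2)`. -/
noncomputable def complexGaussian (v : ℝ≥0) : Measure ℂ :=
  ((gaussianReal 0 (v / 2)).prod (gaussianReal 0 (v / 2))).map
    (fun q : ℝ × ℝ => (q.1 : ℂ) + (q.2 : ℂ) * Complex.I)

/-- `c * g` has law `CN(0, c ^ 2)` when `g` has law `CN(0, 1)`. -/
theorem complexGaussian_map_mul (c : ℝ) :
    (complexGaussian 1).map (fun g => (c : ℂ) * g) = complexGaussian (c ^ 2).toNNReal := by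
  have h : gaussianReal 0 ((c ^ 2).toNNReal / 2)
      = (gaussianReal 0 (1 / 2)).map (fun x => c * x) := by
    rw [gaussianReal_map_const_mul]
    congr 1
    · simp
    · rw [mul_one_div]
      congr 1
      ext
      simp [sq_nonneg]
  unfold complexGaussian
  rw [h, Measure.map_prod_map _ _ (by fun_prop) (by fun_prop),
    Measure.map_map (by fun_prop) (by fun_prop), Measure.map_map (by fun_prop) (by fun_prop)]
  congr 1
  ext q
  simp
  ring

/-- The law `CN(0, R)` on `ℂ^N`, for positive semidefinite `R`: every linear functional `aᴴ x` is
circularly-symmetric complex Gaussian with variance `aᴴ R a`. -/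
def IsComplexGaussian {N : ℕ} (μ : Measure (Fin N → ℂ)) (R : Matrix (Fin N) (Fin N) ℂ) : Prop :=
  R.PosSemidef ∧ ∀ a : Fin N → ℂ,
    μ.map (fun x => star a ⬝ᵥ x) = complexGaussian (star a ⬝ᵥ R.mulVec a).re.toNNReal

/-- The unit-norm beamformers: deterministic functions `w` of the channel estimate with
Euclidean norm `‖w‖ = 1`. -/
def Beamformer (N : ℕ) : Set ((Fin N → ℂ) → (Fin N → ℂ)) :=
  {w | Measurable w ∧ ∀ x, ∑ i, ‖w x i‖ ^ 2 = 1}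

/-- The admissible laws of the data signal `s`: `E|s|² ≤ p`. -/
def InputLaw (p : ℝ) : Set (Measure ℂ) :=
  {f | IsProbabilityMeasure f ∧ ∫⁻ s, ‖s‖ₑ ^ 2 ∂f ≤ ENNReal.ofReal p}

/-- Independent `CN(0, 1)` variables: one per transmit antenna, one for the receiver noise and one
for the receiver distortion. -/
noncomputable def noiseLaw (N : ℕ) : Measure ((Fin N → ℂ) × ℂ × ℂ) :=
  (Measure.pi fun _ => complexGaussian 1).prod ((complexGaussian 1).prod (complexGaussian 1))

/-- The received signal `y = hᵀ (w s + η_t) + n + η_r` for channel `h`, beamforming vector `w` and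
data symbol `s`. The distortions and the noise are scaled standard Gaussians, so that for given
`h, w` they are independent with `η_t ∼ CN(0, κt p diag(|w_1|², …, |w_N|²))`, `n ∼ CN(0, σ²)` and
`η_r ∼ CN(0, κr p |hᵀ w|²)`. -/
noncomputable def received {N : ℕ} (κt κr p σ : ℝ) (h w : Fin N → ℂ) (s : ℂ)
    (g : (Fin N → ℂ) × ℂ × ℂ) : ℂ :=
  h ⬝ᵥ (fun i => w i * s + ((√(κt * p) * ‖w i‖ : ℝ) : ℂ) * g.1 i)
    + (σ : ℂ) * g.2.1 + ((√(κr * p) * ‖h ⬝ᵥ w‖ : ℝ) : ℂ) * g.2.2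

/-- The joint law of `(s, y)` when `(h, ĥ)` has law `ρ`, the beamforming vector is `w(ĥ)`, and the
data signal `s`, of law `f`, the pair `(h, ĥ)` and the Gaussian noises are independent. -/
noncomputable def inputOutputLaw {N : ℕ} (κt κr p σ : ℝ) (ρ : Measure ((Fin N → ℂ) × (Fin N → ℂ)))
    (w : (Fin N → ℂ) → (Fin N → ℂ)) (f : Measure ℂ) : Measure (ℂ × ℂ) :=
  ((ρ.prod f).prod (noiseLaw N)).map
    (fun q => (q.1.2, received κt κr p σ q.1.1.1 (w q.1.1.2) q.1.2 q.2))

/-- Mutual information, in bits, of two random variables with joint law `μ`: the Kullback-Leibler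
divergence of the joint law from the product of its marginals. -/
noncomputable def mutualInfo (μ : Measure (ℂ × ℂ)) : ℝ≥0∞ :=
  klDiv μ (μ.fst.prod μ.snd) / ENNReal.ofReal (Real.log 2)

/-- The capacity (bits per channel use) `E { max_{w(ĥ)} max_{f(s)} I(s; y) }` of the fading
downlink. The base station knows `ĥ`; the terminal knows `U = g(ĥ)` and the side information `Z`.
The outer expectation is over the state `U` known to both ends, for each value of which the
beamformer and the input law are optimized, and `I(s; y)` is the mutual information given the
knowledge `(U, Z)` of the terminal, averaged over `Z`.
With `g` and `Z` constant the terminal has no channel knowledge; with `g = id` and `Z = h`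
it has perfect knowledge. -/
noncomputable def capacity {Ω 𝒰 𝒵 : Type*} [MeasurableSpace Ω] [MeasurableSpace 𝒰]
    [MeasurableSpace 𝒵] [StandardBorelSpace 𝒵] [Nonempty 𝒵] {N : ℕ} (κt κr p σ : ℝ)
    (P : Measure Ω) [IsFiniteMeasure P] (h hhat : Ω → Fin N → ℂ) (g : (Fin N → ℂ) → 𝒰)
    (Z : Ω → 𝒵) : ℝ≥0∞ :=
  ∫⁻ u, ⨆ w ∈ Beamformer N, ⨆ f ∈ InputLaw p,
    ∫⁻ z, mutualInfo (inputOutputLaw κt κr p σ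
        (condDistrib (fun ω => (h ω, hhat ω)) (fun ω => (g (hhat ω), Z ω)) P (u, z)) w f)
      ∂(condDistrib Z (fun ω => g (hhat ω)) P u)
    ∂(P.map fun ω => g (hhat ω))

/-- The effective signal-to-interference-and-noise ratio of the beamforming vector `v`. -/
noncomputable def effectiveSINR {Ω : Type*} [MeasurableSpace Ω] {N : ℕ} (κt κr p σ : ℝ)
    (P : Measure Ω) (h v : Ω → Fin N → ℂ) : ℝ :=
  ‖∫ ω, h ω ⬝ᵥ v ω ∂P‖ ^ 2 /
    ((1 + κr) * (∫ ω, ‖h ω ⬝ᵥ v ω‖ ^ 2 ∂P) - ‖∫ ω, h ω ⬝ᵥ v ω ∂P‖ ^ 2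
      + κt * (∑ i, ∫ ω, ‖h ω i‖ ^ 2 * ‖v ω i‖ ^ 2 ∂P) + σ ^ 2 / p)

end MISO

/-! Take a Gaussian input `CN(0, p)` and bound the mutual information through a linear estimate `a
y` of `s`. The Donsker-Varadhan inequality, with the log-ratio of the densities of `CN(a y, τ)` and
`CN(0, p)` as test function, gives in nats `I(s; y) ≥ log (p / τ) + 1 - E|s - a y|² / τ` for every
joint law with this input (`lintegral_le_klDiv_add_lintegral`, `log_le_klDiv_add_lintegral`). The
output need not be Gaussian.

The bound is affine in the mean square error. With `a` and `τ` the same for all values of `(U, Z)`,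
averaging over the terminal's knowledge therefore leaves only the unconditional error, whatever that
knowledge is (`log_le_mul_capacity_add_lintegral`). Choosing `a` as the unconditional LMMSE
coefficient and `τ` as its error cancels the last two terms, and `p / τ` is `1 + SINR`
(`logb_le_capacity_of_mem_beamformer`). -/

namespace MISO

/-! ### Variational bound for the divergence -/

/-- A one-sided form of the Donsker-Varadhan variational bound, for the test function `A - B`. -/
theorem lintegral_le_klDiv_add_lintegral {α : Type*} [MeasurableSpace α] (μ ν : Measure α)
    [IsProbabilityMeasure μ] [IsProbabilityMeasure ν] {A B : α → ℝ} (hA : Measurable A)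
    (hB : Measurable B) (hA0 : ∀ x, 0 ≤ A x) (hB0 : ∀ x, 0 ≤ B x)
    (hexp : ∫⁻ x, ENNReal.ofReal (Real.exp (A x - B x)) ∂ν ≤ 1) :
    ∫⁻ x, ENNReal.ofReal (A x) ∂μ ≤ klDiv μ ν + ∫⁻ x, ENNReal.ofReal (B x) ∂μ := by
  by_cases hac : μ ≪ ν
  swap
  · simp [klDiv_of_not_ac hac]
  -- Fenchel-Young for `klFun`: this is `1 + x ≤ exp x` at `x = a - b - log f`, multiplied by `f`.
  have hpt : ∀ f a b : ℝ, 0 ≤ f → f * a + 1 ≤ klFun f + Real.exp (a - b) + f * b := by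
    intro f a b hf
    rcases hf.eq_or_lt with rfl | hf
    · have := Real.exp_pos (a - b)
      simp [klFun_zero]
      positivity
    · have h1 := Real.add_one_le_exp (a - b - Real.log f)
      rw [Real.exp_sub _ (Real.log f), Real.exp_log hf, le_div_iff₀ hf] at h1
      rw [klFun_apply]
      nlinarith
  have hr : ∀ᵐ x ∂ν, μ.rnDeriv ν x < ∞ := μ.rnDeriv_lt_top ν
  -- Keeping `B` and the `1` on opposite sides avoids subtraction, so no integrability is needed.
  have key : ∫⁻ x, ENNReal.ofReal (A x) ∂μ + 1
      ≤ klDiv μ ν + ∫⁻ x, ENNReal.ofReal (Real.exp (A x - B x)) ∂ν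
        + ∫⁻ x, ENNReal.ofReal (B x) ∂μ := by
    have m1 : Measurable fun x => ENNReal.ofReal (A x) := hA.ennreal_ofReal
    have m2 : Measurable fun x => ENNReal.ofReal (B x) := hB.ennreal_ofReal
    rw [klDiv_eq_lintegral_klFun_of_ac hac, ← lintegral_rnDeriv_mul hac m1.aemeasurable,
      ← lintegral_rnDeriv_mul hac m2.aemeasurable,
      ← lintegral_add_right _ (by fun_prop),
      ← lintegral_add_right _ (show Measurable fun x => μ.rnDeriv ν x * ENNReal.ofReal (B x) from
        (μ.measurable_rnDeriv ν).mul m2)]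
    have h1 : (1 : ℝ≥0∞) = ∫⁻ _, 1 ∂ν := by simp
    rw [h1, ← lintegral_add_right _ measurable_const]
    refine lintegral_mono_ae ?_
    filter_upwards [hr] with x hx
    have hf : 0 ≤ (μ.rnDeriv ν x).toReal := ENNReal.toReal_nonneg
    conv_lhs => rw [← ENNReal.ofReal_toReal hx.ne]
    conv_rhs => rw [← ENNReal.ofReal_toReal hx.ne]
    rw [← ENNReal.ofReal_mul hf, ← ENNReal.ofReal_mul hf, ENNReal.toReal_ofReal hf,
      ← ENNReal.ofReal_one, ← ENNReal.ofReal_add (mul_nonneg hf (hA0 x)) zero_le_one,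
      ← ENNReal.ofReal_add (klFun_nonneg hf) (Real.exp_pos _).le,
      ← ENNReal.ofReal_add (add_nonneg (klFun_nonneg hf) (Real.exp_pos _).le)
        (mul_nonneg hf (hB0 x))]
    exact ENNReal.ofReal_le_ofReal (hpt _ _ _ hf)
  refine (ENNReal.add_le_add_iff_right ENNReal.one_ne_top).1 (key.trans ?_)
  calc _ ≤ klDiv μ ν + 1 + ∫⁻ x, ENNReal.ofReal (B x) ∂μ := by gcongr
    _ = _ := by ring

/-! ### Gaussian likelihood ratios and second moments -/

/-- The integrand is the density of `N(b, τ)` relative to `N(0, v)`. -/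
theorem lintegral_gaussianReal_likelihoodRatio {v τ : ℝ≥0} (hv : v ≠ 0) (hτ : τ ≠ 0) (b : ℝ) :
    ∫⁻ x, ENNReal.ofReal (√(v / τ) * Real.exp (x ^ 2 / (2 * v) - (x - b) ^ 2 / (2 * τ)))
      ∂(gaussianReal 0 v) = 1 := by
  rw [gaussianReal_of_var_ne_zero _ hv, lintegral_withDensity_eq_lintegral_mul _
    (measurable_gaussianPDF 0 v) (by fun_prop), ← lintegral_gaussianPDF_eq_one b hτ]
  congr with x
  simp only [Pi.mul_apply, gaussianPDF]
  rw [← ENNReal.ofReal_mul (gaussianPDFReal_nonneg _ _ _)]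
  congr 1
  simp only [gaussianPDFReal]
  have hv' : (0 : ℝ) < v := by positivity
  have hτ' : (0 : ℝ) < τ := by positivity
  have e : Real.exp (-(x - 0) ^ 2 / (2 * v)) * Real.exp (x ^ 2 / (2 * v) - (x - b) ^ 2 / (2 * τ))
      = Real.exp (-(x - b) ^ 2 / (2 * τ)) := by
    rw [← Real.exp_add]; congr 1; ring
  rw [← e, Real.sqrt_div hv'.le, Real.sqrt_mul (x := 2 * Real.pi) (by positivity),
    Real.sqrt_mul (x := 2 * Real.pi) (by positivity)]
  have := Real.sqrt_pos.2 hv'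
  have := Real.sqrt_pos.2 hτ'
  field_simp

instance (v : ℝ≥0) : IsProbabilityMeasure (complexGaussian v) :=
  Measure.isProbabilityMeasure_map (by fun_prop)

theorem lintegral_complexGaussian (v : ℝ≥0) {F : ℂ → ℝ≥0∞} (hF : Measurable F) :
    ∫⁻ s, F s ∂(complexGaussian v)
      = ∫⁻ x, ∫⁻ y, F (x + y * Complex.I) ∂(gaussianReal 0 (v / 2)) ∂(gaussianReal 0 (v / 2)) := by
  rw [complexGaussian, lintegral_map hF (by fun_prop), lintegral_prod _ (by fun_prop)]

/-- The ratio factors over real and imaginary parts, each contributing `√(v / τ)`. With `b = a y`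
this normalizes the test function for every fixed output `y`. -/
theorem lintegral_complexGaussian_likelihoodRatio {v τ : ℝ≥0} (hv : v ≠ 0) (hτ : τ ≠ 0) (b : ℂ) :
    ∫⁻ s, ENNReal.ofReal (Real.exp (Real.log (v / τ) + ‖s‖ ^ 2 / v - ‖s - b‖ ^ 2 / τ))
      ∂(complexGaussian v) = 1 := by
  have hv' : (0 : ℝ) < v := by positivity
  have hτ' : (0 : ℝ) < τ := by positivity
  rw [lintegral_complexGaussian _ (by fun_prop)]
  have hv2 : v / 2 ≠ 0 := by positivity
  have hτ2 : τ / 2 ≠ 0 := by positivity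
  have e : ∀ x y : ℝ, ENNReal.ofReal (Real.exp (Real.log (v / τ) + ‖(x + y * Complex.I : ℂ)‖ ^ 2 / v
        - ‖(x + y * Complex.I : ℂ) - b‖ ^ 2 / τ))
      = ENNReal.ofReal (√((v / 2 : ℝ≥0) / (τ / 2 : ℝ≥0)) * Real.exp (x ^ 2 / (2 * (v / 2 : ℝ≥0))
          - (x - b.re) ^ 2 / (2 * (τ / 2 : ℝ≥0))))
        * ENNReal.ofReal (√((v / 2 : ℝ≥0) / (τ / 2 : ℝ≥0)) * Real.exp (y ^ 2 / (2 * (v / 2 : ℝ≥0))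
          - (y - b.im) ^ 2 / (2 * (τ / 2 : ℝ≥0)))) := by
    intro x y
    rw [← ENNReal.ofReal_mul (by positivity)]
    congr 1
    have hs : √((v / 2 : ℝ≥0) / (τ / 2 : ℝ≥0)) * √((v / 2 : ℝ≥0) / (τ / 2 : ℝ≥0))
        = Real.exp (Real.log (v / τ)) := by
      rw [Real.mul_self_sqrt (by positivity), Real.exp_log (by positivity)]
      push_cast
      field_simp
    rw [mul_mul_mul_comm, hs, ← Real.exp_add, ← Real.exp_add]
    congr 1
    rw [← Complex.normSq_eq_norm_sq, ← Complex.normSq_eq_norm_sq]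
    simp [Complex.normSq_apply]
    field_simp
    ring
  simp_rw [e]
  have m : ∀ x, AEMeasurable (fun y : ℝ => ENNReal.ofReal (√((v / 2 : ℝ≥0) / (τ / 2 : ℝ≥0)) *
    Real.exp (y ^ 2 / (2 * (v / 2 : ℝ≥0)) - (y - x) ^ 2 / (2 * (τ / 2 : ℝ≥0)))))
      (gaussianReal 0 (v / 2)) := fun x => by fun_prop
  simp_rw [lintegral_const_mul'' _ (m _), lintegral_gaussianReal_likelihoodRatio hv2 hτ2, mul_one,
    lintegral_gaussianReal_likelihoodRatio hv2 hτ2]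

theorem lintegral_gaussianReal_affine_sq (v : ℝ≥0) (c d : ℝ) :
    ∫⁻ x, ENNReal.ofReal ((c + d * x) ^ 2) ∂(gaussianReal 0 v) = ENNReal.ofReal (c ^ 2 + d ^ 2 * v) := by
  have hm : MemLp (fun x : ℝ => x) 2 (gaussianReal 0 v) := memLp_id_gaussianReal' 2 (by simp)
  have i1 : Integrable (fun x : ℝ => x) (gaussianReal 0 v) := hm.integrable (by norm_num)
  have i2 : Integrable (fun x : ℝ => x ^ 2) (gaussianReal 0 v) := hm.integrable_sq
  have e2 : ∫ x, x ^ 2 ∂(gaussianReal 0 v) = v := by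
    have := variance_fun_id_gaussianReal (μ := 0) (v := v)
    rwa [variance_of_integral_eq_zero (by fun_prop) (by simp)] at this
  have e : (fun x : ℝ => (c + d * x) ^ 2) = fun x => c ^ 2 + (2 * c * d) * x + d ^ 2 * x ^ 2 := by
    ext x; ring
  have i3 : Integrable (fun x : ℝ => c ^ 2 + (2 * c * d) * x) (gaussianReal 0 v) :=
    (integrable_const _).add (i1.const_mul _)
  have i4 : Integrable (fun x : ℝ => d ^ 2 * x ^ 2) (gaussianReal 0 v) := i2.const_mul _
  rw [← ofReal_integral_eq_lintegral_ofReal]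
  · rw [e, integral_add i3 i4, integral_add (integrable_const _) (i1.const_mul _),
      integral_const_mul, integral_const_mul, e2]
    simp
  · rw [e]; exact i3.add i4
  · exact ae_of_all _ fun x => sq_nonneg _

theorem enorm_sq_eq_ofReal (z : ℂ) : ‖z‖ₑ ^ 2 = ENNReal.ofReal (‖z‖ ^ 2) := by
  rw [ENNReal.ofReal_pow (norm_nonneg _), ofReal_norm]

theorem lintegral_complexGaussian_affine_sq (v : ℝ≥0) (z c : ℂ) :
    ∫⁻ s, ‖z + c * s‖ₑ ^ 2 ∂(complexGaussian v) = ‖z‖ₑ ^ 2 + ‖c‖ₑ ^ 2 * v := by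
  rw [lintegral_complexGaussian _ (by fun_prop)]
  have e : ∀ x y : ℝ, ‖z + c * (x + y * Complex.I)‖ₑ ^ 2
      = ENNReal.ofReal (((z.re + c.re * x) + (-c.im) * y) ^ 2)
        + ENNReal.ofReal (((z.im + c.im * x) + c.re * y) ^ 2) := by
    intro x y
    rw [enorm_sq_eq_ofReal, ← ENNReal.ofReal_add (sq_nonneg _) (sq_nonneg _),
      ← Complex.normSq_eq_norm_sq]
    congr 1
    simp [Complex.normSq_apply]
    ring
  simp_rw [e]
  have e' : ∀ x : ℝ, ∫⁻ y : ℝ, ENNReal.ofReal (((z.re + c.re * x) + (-c.im) * y) ^ 2)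
        + ENNReal.ofReal (((z.im + c.im * x) + c.re * y) ^ 2) ∂(gaussianReal 0 (v / 2))
      = ENNReal.ofReal ((z.re + c.re * x) ^ 2) + ENNReal.ofReal ((z.im + c.im * x) ^ 2)
        + ENNReal.ofReal (‖c‖ ^ 2 * (v / 2)) := by
    intro x
    rw [lintegral_add_left (by fun_prop), lintegral_gaussianReal_affine_sq,
      lintegral_gaussianReal_affine_sq, ← ENNReal.ofReal_add (by positivity) (by positivity),
      ← ENNReal.ofReal_add (by positivity) (by positivity),
      ← ENNReal.ofReal_add (by positivity) (by positivity), ← Complex.normSq_eq_norm_sq]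
    congr 1
    simp [Complex.normSq_apply]
    ring
  simp_rw [e']
  rw [lintegral_add_left (by fun_prop), lintegral_add_left (by fun_prop),
    lintegral_gaussianReal_affine_sq, lintegral_gaussianReal_affine_sq, lintegral_const,
    measure_univ, mul_one, enorm_sq_eq_ofReal, enorm_sq_eq_ofReal,
    ← ENNReal.ofReal_coe_nnreal, ← ENNReal.ofReal_mul (by positivity),
    ← ENNReal.ofReal_add (by positivity) (by positivity),
    ← ENNReal.ofReal_add (by positivity) (by positivity),
    ← ENNReal.ofReal_add (by positivity) (by positivity),
    ← Complex.normSq_eq_norm_sq, ← Complex.normSq_eq_norm_sq]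
  congr 1
  simp [Complex.normSq_apply]
  ring

theorem lintegral_complexGaussian_sq (v : ℝ≥0) : ∫⁻ s, ‖s‖ₑ ^ 2 ∂(complexGaussian v) = v := by
  simpa using lintegral_complexGaussian_affine_sq v 0 1

/-- The free offset `z` drives the induction: it absorbs the coordinate that is split off. -/
theorem lintegral_pi_complexGaussian_affine_sq (v : ℝ≥0) {N : ℕ} (z : ℂ) (d : Fin N → ℂ) :
    ∫⁻ x, ‖z + ∑ i, d i * x i‖ₑ ^ 2 ∂(Measure.pi fun _ => complexGaussian v)
      = ‖z‖ₑ ^ 2 + (∑ i, ‖d i‖ₑ ^ 2) * v := by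
  induction N generalizing z with
  | zero => simp
  | succ n ih =>
    have hmp := measurePreserving_piFinSuccAbove (fun _ : Fin (n + 1) => complexGaussian v) 0
    have := hmp.lintegral_comp (f := fun q : ℂ × (Fin n → ℂ) =>
      ‖(z + d 0 * q.1) + ∑ i : Fin n, d i.succ * q.2 i‖ₑ ^ 2) (by fun_prop)
    simp only [MeasurableEquiv.piFinSuccAbove_apply, Fin.insertNthEquiv_zero,
      Fin.consEquiv_symm_apply] at this
    simp_rw [Fin.sum_univ_succ, ← add_assoc]
    refine this.trans ?_
    rw [lintegral_prod _ (by fun_prop)]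
    simp_rw [ih]
    rw [lintegral_add_right _ measurable_const, lintegral_complexGaussian_affine_sq]
    simp [add_mul, add_assoc]

instance (N : ℕ) : IsProbabilityMeasure (noiseLaw N) := by
  unfold noiseLaw; infer_instance

/-! ### Mean square error of linear estimates over the channel -/

theorem measurable_received {N : ℕ} (κt κr p σ : ℝ) {w : (Fin N → ℂ) → (Fin N → ℂ)}
    (hw : Measurable w) :
    Measurable fun q : (((Fin N → ℂ) × (Fin N → ℂ)) × ℂ) × ((Fin N → ℂ) × ℂ × ℂ) =>
      received κt κr p σ q.1.1.1 (w q.1.1.2) q.1.2 q.2 := by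
  unfold received dotProduct
  fun_prop

/-- The mean square error of the linear estimate `a y` of `s ∼ CN(0, v)` for the channel `h` and
the beamforming vector `w`. -/
noncomputable def estimationError {N : ℕ} (κt κr p σ : ℝ) (v : ℝ≥0) (a : ℂ) (h w : Fin N → ℂ) :
    ℝ :=
  ‖1 - a * (h ⬝ᵥ w)‖ ^ 2 * v + ‖a‖ ^ 2 * (κt * p * (∑ i, ‖h i‖ ^ 2 * ‖w i‖ ^ 2) + σ ^ 2
    + κr * p * ‖h ⬝ᵥ w‖ ^ 2)

theorem estimationError_nonneg {N : ℕ} {κt κr p : ℝ} (σ : ℝ) (hκt : 0 ≤ κt) (hκr : 0 ≤ κr)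
    (hp : 0 ≤ p) (v : ℝ≥0) (a : ℂ) (h w : Fin N → ℂ) :
    0 ≤ estimationError κt κr p σ v a h w := by
  unfold estimationError; positivity

/-- For fixed `h` and `w` the residual is linear in independent centred Gaussians, so the cross
terms vanish and the squared coefficients add up. -/
theorem lintegral_estimationError {N : ℕ} {κt κr p : ℝ} (σ : ℝ) (hκt : 0 ≤ κt) (hκr : 0 ≤ κr)
    (hp : 0 ≤ p) (v : ℝ≥0) (a : ℂ) (h w : Fin N → ℂ) :
    ∫⁻ s, ∫⁻ n, ‖s - a * received κt κr p σ h w s n‖ₑ ^ 2 ∂(noiseLaw N) ∂(complexGaussian v)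
      = ENNReal.ofReal (estimationError κt κr p σ v a h w) := by
  -- The leading `0` gives the innermost term the shape `z + c * s` of the affine moment lemma.
  have e : ∀ s : ℂ, ∀ n : (Fin N → ℂ) × ℂ × ℂ, s - a * received κt κr p σ h w s n
      = ((0 + (1 - a * (h ⬝ᵥ w)) * s + ∑ i, (-(a * h i * ((√(κt * p) * ‖w i‖ : ℝ) : ℂ))) * n.1 i)
        + (-(a * σ)) * n.2.1) + (-(a * ((√(κr * p) * ‖h ⬝ᵥ w‖ : ℝ) : ℂ))) * n.2.2 := by
    intro s n
    have h1 : h ⬝ᵥ (fun i => w i * s + ((√(κt * p) * ‖w i‖ : ℝ) : ℂ) * n.1 i)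
        = (h ⬝ᵥ w) * s + ∑ i, h i * ((√(κt * p) * ‖w i‖ : ℝ) : ℂ) * n.1 i := by
      simp only [dotProduct, Finset.sum_mul, ← Finset.sum_add_distrib]
      exact Finset.sum_congr rfl fun i _ => by ring
    have h2 : ∑ i, (-(a * h i * ((√(κt * p) * ‖w i‖ : ℝ) : ℂ))) * n.1 i
        = - a * ∑ i, h i * ((√(κt * p) * ‖w i‖ : ℝ) : ℂ) * n.1 i := by
      rw [Finset.mul_sum]
      exact Finset.sum_congr rfl fun i _ => by ring
    rw [received, h1, h2]
    ring
  simp_rw [e, noiseLaw]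
  have e2 : ∀ s : ℂ, ∫⁻ n : (Fin N → ℂ) × ℂ × ℂ,
      ‖((0 + (1 - a * (h ⬝ᵥ w)) * s + ∑ i, (-(a * h i * ((√(κt * p) * ‖w i‖ : ℝ) : ℂ))) * n.1 i)
        + (-(a * σ)) * n.2.1) + (-(a * ((√(κr * p) * ‖h ⬝ᵥ w‖ : ℝ) : ℂ))) * n.2.2‖ₑ ^ 2
        ∂((Measure.pi fun _ => complexGaussian 1).prod
          ((complexGaussian 1).prod (complexGaussian 1)))
      = ‖0 + (1 - a * (h ⬝ᵥ w)) * s‖ₑ ^ 2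
        + ((∑ i, ‖-(a * h i * ((√(κt * p) * ‖w i‖ : ℝ) : ℂ))‖ₑ ^ 2) + ‖-(a * (σ : ℂ))‖ₑ ^ 2
          + ‖-(a * ((√(κr * p) * ‖h ⬝ᵥ w‖ : ℝ) : ℂ))‖ₑ ^ 2) := by
    intro s
    rw [lintegral_prod _ (by fun_prop)]
    have e3 : ∀ x : Fin N → ℂ, ∫⁻ m : ℂ × ℂ,
      ‖((0 + (1 - a * (h ⬝ᵥ w)) * s + ∑ i, (-(a * h i * ((√(κt * p) * ‖w i‖ : ℝ) : ℂ))) * x i)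
        + (-(a * σ)) * m.1) + (-(a * ((√(κr * p) * ‖h ⬝ᵥ w‖ : ℝ) : ℂ))) * m.2‖ₑ ^ 2
        ∂((complexGaussian 1).prod (complexGaussian 1))
        = ‖0 + (1 - a * (h ⬝ᵥ w)) * s
            + ∑ i, (-(a * h i * ((√(κt * p) * ‖w i‖ : ℝ) : ℂ))) * x i‖ₑ ^ 2
          + ‖-(a * (σ : ℂ))‖ₑ ^ 2 + ‖-(a * ((√(κr * p) * ‖h ⬝ᵥ w‖ : ℝ) : ℂ))‖ₑ ^ 2 := by
      intro x
      rw [lintegral_prod _ (by fun_prop)]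
      simp_rw [lintegral_complexGaussian_affine_sq]
      rw [lintegral_add_right _ measurable_const, lintegral_complexGaussian_affine_sq]
      simp
    simp_rw [e3]
    rw [lintegral_add_right _ measurable_const, lintegral_add_right _ measurable_const,
      lintegral_pi_complexGaussian_affine_sq]
    simp [add_assoc]
  simp_rw [e2]
  rw [lintegral_add_right _ measurable_const, lintegral_complexGaussian_affine_sq]
  simp only [lintegral_const, measure_univ, mul_one, enorm_sq_eq_ofReal,
    ← ENNReal.ofReal_coe_nnreal]
  rw [← ENNReal.ofReal_sum_of_nonneg (fun i _ => by positivity)]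
  rw [← ENNReal.ofReal_mul (by positivity), ← ENNReal.ofReal_add (by positivity) (by positivity),
    ← ENNReal.ofReal_add (by positivity) (by positivity),
    ← ENNReal.ofReal_add (by positivity) (by positivity),
    ← ENNReal.ofReal_add (by positivity) (by positivity)]
  congr 1
  have ht : √(κt * p) ^ 2 = κt * p := Real.sq_sqrt (by positivity)
  have hr : √(κr * p) ^ 2 = κr * p := Real.sq_sqrt (by positivity)
  simp only [norm_neg, norm_mul, Complex.norm_real, norm_zero, Real.norm_eq_abs, mul_pow, sq_abs,
    abs_norm, ht, hr, estimationError]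
  have : ∑ i, ‖a‖ ^ 2 * ‖h i‖ ^ 2 * (κt * p * ‖w i‖ ^ 2)
      = ‖a‖ ^ 2 * (κt * p) * ∑ i, ‖h i‖ ^ 2 * ‖w i‖ ^ 2 := by
    rw [Finset.mul_sum]
    exact Finset.sum_congr rfl fun i _ => by ring
  rw [this]
  ring

theorem isProbabilityMeasure_inputOutputLaw {N : ℕ} (κt κr p σ : ℝ)
    (ρ : Measure ((Fin N → ℂ) × (Fin N → ℂ))) [IsProbabilityMeasure ρ]
    {w : (Fin N → ℂ) → (Fin N → ℂ)} (hw : Measurable w) (f : Measure ℂ) [IsProbabilityMeasure f] :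
    IsProbabilityMeasure (inputOutputLaw κt κr p σ ρ w f) :=
  Measure.isProbabilityMeasure_map
    (Measurable.aemeasurable (by have := measurable_received κt κr p σ hw; fun_prop))

theorem fst_inputOutputLaw {N : ℕ} (κt κr p σ : ℝ)
    (ρ : Measure ((Fin N → ℂ) × (Fin N → ℂ))) [IsProbabilityMeasure ρ]
    {w : (Fin N → ℂ) → (Fin N → ℂ)} (hw : Measurable w) (f : Measure ℂ) [IsProbabilityMeasure f] :
    (inputOutputLaw κt κr p σ ρ w f).fst = f := by
  rw [inputOutputLaw, Measure.fst_map_prodMk (measurable_received κt κr p σ hw)]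
  have : (fun q : (((Fin N → ℂ) × (Fin N → ℂ)) × ℂ) × ((Fin N → ℂ) × ℂ × ℂ) => q.1.2)
      = Prod.snd ∘ Prod.fst := rfl
  rw [this, ← Measure.map_map measurable_snd measurable_fst]
  change ((ρ.prod f).prod (noiseLaw N)).fst.snd = f
  rw [Measure.fst_prod, Measure.snd_prod]

theorem lintegral_inputOutputLaw_sub_sq {N : ℕ} {κt κr p : ℝ} (σ : ℝ) (hκt : 0 ≤ κt) (hκr : 0 ≤ κr)
    (hp : 0 ≤ p) (v : ℝ≥0) (a : ℂ) (ρ : Measure ((Fin N → ℂ) × (Fin N → ℂ)))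
    [IsProbabilityMeasure ρ] {w : (Fin N → ℂ) → (Fin N → ℂ)} (hw : Measurable w) :
    ∫⁻ q, ‖q.1 - a * q.2‖ₑ ^ 2 ∂(inputOutputLaw κt κr p σ ρ w (complexGaussian v))
      = ∫⁻ x, ENNReal.ofReal (estimationError κt κr p σ v a x.1 (w x.2)) ∂ρ := by
  have hm := measurable_received κt κr p σ hw
  rw [inputOutputLaw, lintegral_map (by fun_prop) (by fun_prop),
    lintegral_prod _ (by fun_prop), lintegral_prod _ (by fun_prop)]
  simp_rw [lintegral_estimationError σ hκt hκr hp]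

/-! ### Mutual information bound for one state of knowledge -/

/-- The mutual information of a `CN(0, v)` input is bounded below through the mean square error
of any linear estimate. -/
theorem log_le_klDiv_add_lintegral {v τ : ℝ≥0} (hτ : τ ≠ 0) (hτv : τ ≤ v) (a : ℂ)
    (μ : Measure (ℂ × ℂ)) [IsProbabilityMeasure μ] (hμ : μ.fst = complexGaussian v) :
    ENNReal.ofReal (Real.log (v / τ)) + 1
      ≤ klDiv μ (μ.fst.prod μ.snd) + (∫⁻ q, ‖q.1 - a * q.2‖ₑ ^ 2 ∂μ) / τ := by
  have hτ' : (0 : ℝ) < τ := by positivity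
  have hτv' : (τ : ℝ) ≤ v := hτv
  have hv' : (0 : ℝ) < v := hτ'.trans_le hτv'
  have hv : v ≠ 0 := by exact_mod_cast hv'.ne'
  have hlog : 0 ≤ Real.log (v / τ) := Real.log_nonneg ((one_le_div hτ').2 hτv')
  -- `A - B` is the log-ratio of `CN(a y, τ)` to `CN(0, v)`; `A` is nonnegative because `τ ≤ v`.
  -- Under the product law, integrating over `s` first gives `1` for each `y`.
  have key := lintegral_le_klDiv_add_lintegral μ (μ.fst.prod μ.snd)
    (A := fun q => Real.log (v / τ) + ‖q.1‖ ^ 2 / v) (B := fun q => ‖q.1 - a * q.2‖ ^ 2 / τ)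
    (by fun_prop) (by fun_prop) (fun q => by positivity) (fun q => by positivity) (by
      rw [lintegral_prod_symm _ (by fun_prop), hμ]
      simp_rw [lintegral_complexGaussian_likelihoodRatio hv hτ]
      simp)
  -- The `1` is `E|s|² / v`.
  have hA : ∫⁻ q, ENNReal.ofReal (Real.log (v / τ) + ‖q.1‖ ^ 2 / v) ∂μ
      = ENNReal.ofReal (Real.log (v / τ)) + 1 := by
    have h1 : ∫⁻ q, ENNReal.ofReal (Real.log (v / τ) + ‖q.1‖ ^ 2 / v) ∂μ
        = ∫⁻ s, ENNReal.ofReal (Real.log (v / τ) + ‖s‖ ^ 2 / v) ∂μ.fst := by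
      rw [Measure.fst, lintegral_map (by fun_prop) measurable_fst]
    rw [h1, hμ]
    simp_rw [ENNReal.ofReal_add hlog (div_nonneg (sq_nonneg _) hv'.le),
      ENNReal.ofReal_div_of_pos hv', ← enorm_sq_eq_ofReal, ENNReal.ofReal_coe_nnreal, div_eq_mul_inv]
    rw [lintegral_add_left measurable_const, lintegral_mul_const _ (by fun_prop),
      lintegral_complexGaussian_sq,
      ENNReal.mul_inv_cancel (by simpa using hv) (by simp)]
    simp
  have hB : ∫⁻ q, ENNReal.ofReal (‖q.1 - a * q.2‖ ^ 2 / τ) ∂μ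
      = (∫⁻ q, ‖q.1 - a * q.2‖ₑ ^ 2 ∂μ) / τ := by
    simp_rw [ENNReal.ofReal_div_of_pos hτ', ← enorm_sq_eq_ofReal, ENNReal.ofReal_coe_nnreal,
      div_eq_mul_inv]
    rw [lintegral_mul_const _ (by fun_prop)]
  rw [hA, hB] at key
  exact key

theorem complexGaussian_mem_inputLaw {p : ℝ} : complexGaussian p.toNNReal ∈ InputLaw p := by
  refine ⟨inferInstance, ?_⟩
  rw [lintegral_complexGaussian_sq]
  rfl

theorem measurable_estimationError {N : ℕ} (κt κr p σ : ℝ) (v : ℝ≥0) (a : ℂ)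
    {w : (Fin N → ℂ) → (Fin N → ℂ)} (hw : Measurable w) :
    Measurable fun x : (Fin N → ℂ) × (Fin N → ℂ) => estimationError κt κr p σ v a x.1 (w x.2) := by
  unfold estimationError dotProduct
  fun_prop

/-! ### Averaging over the terminal's knowledge -/

/-- Tower property: composing the conditional laws of `Z` and then `X` recovers the joint law. -/
theorem lintegral_lintegral_condDistrib {Ω 𝒰 𝒵 𝒳 : Type*} [MeasurableSpace Ω] [MeasurableSpace 𝒰]
    [MeasurableSpace 𝒵] [StandardBorelSpace 𝒵] [Nonempty 𝒵]
    [MeasurableSpace 𝒳] [StandardBorelSpace 𝒳] [Nonempty 𝒳]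
    (P : Measure Ω) [IsFiniteMeasure P] {U : Ω → 𝒰} (hU : Measurable U) {Z : Ω → 𝒵}
    (hZ : Measurable Z) {X : Ω → 𝒳} (hX : Measurable X) {m : 𝒳 → ℝ≥0∞} (hm : Measurable m) :
    ∫⁻ u, ∫⁻ z, ∫⁻ x, m x ∂(condDistrib X (fun ω => (U ω, Z ω)) P (u, z)) ∂(condDistrib Z U P u)
      ∂(P.map U) = ∫⁻ ω, m (X ω) ∂P := by
  have hM : Measurable fun q : 𝒰 × 𝒵 => ∫⁻ x, m x ∂(condDistrib X (fun ω => (U ω, Z ω)) P q) :=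
    hm.lintegral_kernel
  rw [← Measure.lintegral_compProd hM, compProd_map_condDistrib hZ.aemeasurable,
    ← Measure.lintegral_compProd (f := fun q : (𝒰 × 𝒵) × 𝒳 => m q.2) (by fun_prop),
    compProd_map_condDistrib hX.aemeasurable, lintegral_map (by fun_prop) (by fun_prop)]

theorem log_le_mul_capacity_add_lintegral {Ω 𝒰 𝒵 : Type*} [MeasurableSpace Ω] [MeasurableSpace 𝒰]
    [MeasurableSpace 𝒵] [StandardBorelSpace 𝒵] [Nonempty 𝒵]
    (P : Measure Ω) [IsProbabilityMeasure P] {N : ℕ}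
    {κt κr p : ℝ} (σ : ℝ) (hκt : 0 ≤ κt) (hκr : 0 ≤ κr) (hp : 0 ≤ p)
    {h hhat : Ω → Fin N → ℂ} (hh : Measurable h) (hhhat : Measurable hhat)
    {g : (Fin N → ℂ) → 𝒰} (hg : Measurable g) {Z : Ω → 𝒵} (hZ : Measurable Z)
    {w : (Fin N → ℂ) → (Fin N → ℂ)} (hw : w ∈ Beamformer N) {τ : ℝ≥0} (hτ : τ ≠ 0)
    (hτp : τ ≤ p.toNNReal) (a : ℂ) :
    ENNReal.ofReal (Real.log (p.toNNReal / τ)) + 1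
      ≤ ENNReal.ofReal (Real.log 2) * capacity κt κr p σ P h hhat g Z
        + (∫⁻ ω, ENNReal.ofReal (estimationError κt κr p σ p.toNNReal a (h ω) (w (hhat ω))) ∂P)
          / τ := by
  have hU : Measurable fun ω => g (hhat ω) := hg.comp hhhat
  have hX : Measurable fun ω => (h ω, hhat ω) := hh.prodMk hhhat
  have hm := (measurable_estimationError κt κr p σ p.toNNReal a hw.1).ennreal_ofReal
  set c := ENNReal.ofReal (Real.log (p.toNNReal / τ)) + 1 with hc
  set L := ENNReal.ofReal (Real.log 2) with hL
  have hL0 : L ≠ 0 := by simp [hL, Real.log_pos one_lt_two]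
  have hLt : L ≠ ∞ := ENNReal.ofReal_ne_top
  set K := condDistrib (fun ω => (h ω, hhat ω)) (fun ω => (g (hhat ω), Z ω)) P with hK
  set κ := condDistrib Z (fun ω => g (hhat ω)) P with hκ
  set M : 𝒰 × 𝒵 → ℝ≥0∞ := fun q => ∫⁻ x, ENNReal.ofReal
    (estimationError κt κr p σ p.toNNReal a x.1 (w x.2)) ∂(K q) with hMdef
  have hM : Measurable M := hm.lintegral_kernel
  have hM' : Measurable fun u => ∫⁻ z, M (u, z) ∂(κ u) := hM.lintegral_kernel_prod_right'
  -- `K q` is a probability measure for every `q`, so no null set has to be discarded.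
  have h1 : ∀ q, c ≤ L * mutualInfo (inputOutputLaw κt κr p σ (K q) w (complexGaussian p.toNNReal))
      + M q / τ := by
    intro q
    have := isProbabilityMeasure_inputOutputLaw κt κr p σ (K q) hw.1 (complexGaussian p.toNNReal)
    have h := log_le_klDiv_add_lintegral hτ hτp a
      (inputOutputLaw κt κr p σ (K q) w (complexGaussian p.toNNReal))
      (fst_inputOutputLaw κt κr p σ (K q) hw.1 (complexGaussian p.toNNReal))
    rw [lintegral_inputOutputLaw_sub_sq σ hκt hκr hp _ a (K q) hw.1] at h
    rwa [mutualInfo, ENNReal.mul_div_cancel hL0 hLt]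
  have h2 : ∀ u, c ≤ L * (⨆ w ∈ Beamformer N, ⨆ f ∈ InputLaw p,
      ∫⁻ z, mutualInfo (inputOutputLaw κt κr p σ (K (u, z)) w f) ∂(κ u))
      + (∫⁻ z, M (u, z) ∂(κ u)) / τ := by
    intro u
    have hMu : Measurable fun z => M (u, z) := hM.comp measurable_prodMk_left
    calc c = ∫⁻ _, c ∂(κ u) := by simp
      _ ≤ ∫⁻ z, L * mutualInfo (inputOutputLaw κt κr p σ (K (u, z)) w
          (complexGaussian p.toNNReal)) + M (u, z) / τ ∂(κ u) := lintegral_mono fun z => h1 (u, z)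
      _ = L * ∫⁻ z, mutualInfo (inputOutputLaw κt κr p σ (K (u, z)) w
          (complexGaussian p.toNNReal)) ∂(κ u) + (∫⁻ z, M (u, z) ∂(κ u)) / τ := by
        -- Only the error term needs measurability here: the mutual information need not be
        -- measurable in `z`, nor, in the outer integral, the supremum in `u`.
        simp_rw [div_eq_mul_inv]
        rw [lintegral_add_right _ (by fun_prop), lintegral_const_mul' _ _ hLt,
          lintegral_mul_const _ hMu]
      _ ≤ _ := by
        gcongr
        exact le_iSup₂_of_le w hw (le_iSup₂_of_le (complexGaussian p.toNNReal)
          complexGaussian_mem_inputLaw le_rfl)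
  have : IsProbabilityMeasure (P.map fun ω => g (hhat ω)) :=
    Measure.isProbabilityMeasure_map hU.aemeasurable
  calc c = ∫⁻ _, c ∂(P.map fun ω => g (hhat ω)) := by simp
    _ ≤ _ := lintegral_mono h2
    _ = L * capacity κt κr p σ P h hhat g Z
        + (∫⁻ u, ∫⁻ z, M (u, z) ∂(κ u) ∂(P.map fun ω => g (hhat ω))) / τ := by
      simp_rw [div_eq_mul_inv]
      rw [lintegral_add_right _ (by fun_prop), lintegral_const_mul' _ _ hLt,
        lintegral_mul_const _ hM']
      rfl
    _ = _ := by
      rw [hMdef, hK, hκ, lintegral_lintegral_condDistrib P hU hZ hX hm]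

/-! ### Second moments and the LMMSE choice -/

/-- Finite second moments are all that the bound uses of the Gaussian channel law. -/
theorem IsComplexGaussian.memLp_apply {Ω : Type*} [MeasurableSpace Ω] {P : Measure Ω} {N : ℕ}
    {h : Ω → Fin N → ℂ} (hh : Measurable h) {R : Matrix (Fin N) (Fin N) ℂ}
    (hR : IsComplexGaussian (P.map h) R) (i : Fin N) : MemLp (fun ω => h ω i) 2 P := by
  have h1 := hR.2 (Pi.single i 1)
  rw [Measure.map_map (by unfold dotProduct; fun_prop) hh] at h1
  have e : (fun x : Fin N → ℂ => star (Pi.single i 1 : Fin N → ℂ) ⬝ᵥ x) ∘ h = fun ω => h ω i := by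
    ext ω
    simp
  rw [e] at h1
  have hi : Measurable fun ω => h ω i := by fun_prop
  refine ⟨hi.aestronglyMeasurable, ?_⟩
  rw [eLpNorm_lt_top_iff_lintegral_rpow_enorm_lt_top (by simp) (by simp)]
  simp only [ENNReal.toReal_ofNat, ENNReal.rpow_ofNat]
  rw [← lintegral_map (f := fun s : ℂ => ‖s‖ₑ ^ 2) (by fun_prop) hi, h1]
  rw [lintegral_complexGaussian_sq]
  exact ENNReal.coe_lt_top

theorem norm_dotProduct_sq_le {N : ℕ} (x y : Fin N → ℂ) (hy : ∑ i, ‖y i‖ ^ 2 = 1) :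
    ‖x ⬝ᵥ y‖ ^ 2 ≤ ∑ i, ‖x i‖ ^ 2 := by
  calc ‖x ⬝ᵥ y‖ ^ 2 ≤ (∑ i, ‖x i‖ * ‖y i‖) ^ 2 := by
        gcongr
        exact (norm_sum_le _ _).trans_eq (by simp)
    _ ≤ (∑ i, ‖x i‖ ^ 2) * ∑ i, ‖y i‖ ^ 2 := Finset.sum_mul_sq_le_sq_mul_sq _ _ _
    _ = _ := by rw [hy, mul_one]

theorem norm_integral_sq_le {Ω : Type*} [MeasurableSpace Ω] {P : Measure Ω}
    [IsProbabilityMeasure P] {t : Ω → ℂ} (ht : MemLp t 2 P) :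
    ‖∫ ω, t ω ∂P‖ ^ 2 ≤ ∫ ω, ‖t ω‖ ^ 2 ∂P := by
  have h1 : ‖∫ ω, t ω ∂P‖ ^ 2 ≤ (∫ ω, ‖t ω‖ ∂P) ^ 2 := by
    gcongr
    exact norm_integral_le_integral_norm _
  have h2 := variance_eq_sub ht.norm
  have h3 := variance_nonneg (fun ω => ‖t ω‖) P
  simp only [Pi.pow_apply] at h2
  linarith

theorem integral_estimationError {Ω : Type*} [MeasurableSpace Ω] (P : Measure Ω)
    [IsProbabilityMeasure P] {N : ℕ} (κt κr p σ : ℝ) (v : ℝ≥0) (a : ℂ) {h w : Ω → Fin N → ℂ}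
    (ht : MemLp (fun ω => h ω ⬝ᵥ w ω) 2 P)
    (hs : ∀ i, Integrable (fun ω => ‖h ω i‖ ^ 2 * ‖w ω i‖ ^ 2) P) :
    Integrable (fun ω => estimationError κt κr p σ v a (h ω) (w ω)) P ∧
    ∫ ω, estimationError κt κr p σ v a (h ω) (w ω) ∂P
      = (1 - 2 * (a * ∫ ω, h ω ⬝ᵥ w ω ∂P).re + ‖a‖ ^ 2 * ∫ ω, ‖h ω ⬝ᵥ w ω‖ ^ 2 ∂P) * v
        + ‖a‖ ^ 2 * (κt * p * (∑ i, ∫ ω, ‖h ω i‖ ^ 2 * ‖w ω i‖ ^ 2 ∂P) + σ ^ 2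
          + κr * p * ∫ ω, ‖h ω ⬝ᵥ w ω‖ ^ 2 ∂P) := by
  have i1 : Integrable (fun ω => a * (h ω ⬝ᵥ w ω)) P := (ht.integrable (by norm_num)).const_mul a
  have i1r : Integrable (fun ω => (a * (h ω ⬝ᵥ w ω)).re) P := i1.re
  have i2 : Integrable (fun ω => ‖h ω ⬝ᵥ w ω‖ ^ 2) P := ht.norm.integrable_sq
  have i3 : Integrable (fun ω => ∑ i, ‖h ω i‖ ^ 2 * ‖w ω i‖ ^ 2) P :=
    integrable_finsetSum _ fun i _ => hs i
  have e : (fun ω => estimationError κt κr p σ v a (h ω) (w ω))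
      = fun ω => ((v + ‖a‖ ^ 2 * σ ^ 2) + (-2 * v) * (a * (h ω ⬝ᵥ w ω)).re)
        + ((‖a‖ ^ 2 * (v + κr * p)) * ‖h ω ⬝ᵥ w ω‖ ^ 2
        + (‖a‖ ^ 2 * (κt * p)) * ∑ i, ‖h ω i‖ ^ 2 * ‖w ω i‖ ^ 2) := by
    ext ω
    have : ‖1 - a * (h ω ⬝ᵥ w ω)‖ ^ 2
        = 1 - 2 * (a * (h ω ⬝ᵥ w ω)).re + ‖a‖ ^ 2 * ‖h ω ⬝ᵥ w ω‖ ^ 2 := by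
      rw [← mul_pow, ← norm_mul, ← Complex.normSq_eq_norm_sq, ← Complex.normSq_eq_norm_sq,
        Complex.normSq_apply, Complex.normSq_apply]
      simp only [Complex.sub_re, Complex.sub_im, Complex.one_re, Complex.one_im]
      ring
    rw [estimationError, this]
    ring
  have j1 : Integrable (fun ω => (v + ‖a‖ ^ 2 * σ ^ 2) + (-2 * v) * (a * (h ω ⬝ᵥ w ω)).re) P :=
    (integrable_const _).add (i1r.const_mul _)
  have j2 := i2.const_mul (‖a‖ ^ 2 * (v + κr * p))
  have j3 := i3.const_mul (‖a‖ ^ 2 * (κt * p))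
  have j23 : Integrable (fun ω => (‖a‖ ^ 2 * (v + κr * p)) * ‖h ω ⬝ᵥ w ω‖ ^ 2
      + (‖a‖ ^ 2 * (κt * p)) * ∑ i, ‖h ω i‖ ^ 2 * ‖w ω i‖ ^ 2) P := j2.add j3
  rw [e]
  refine ⟨j1.add j23, ?_⟩
  have hre : ∫ ω, (a * (h ω ⬝ᵥ w ω)).re ∂P = (a * ∫ ω, h ω ⬝ᵥ w ω ∂P).re := by
    rw [← integral_const_mul]
    exact integral_re i1
  rw [integral_add j1 j23, integral_add (integrable_const _) (i1r.const_mul _),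
    integral_add j2 j3, integral_const_mul, integral_const_mul, integral_const_mul, hre,
    integral_finsetSum _ fun i _ => hs i]
  simp
  ring

theorem logb_le_capacity_of_mem_beamformer {Ω 𝒰 𝒵 : Type*} [MeasurableSpace Ω] [MeasurableSpace 𝒰]
    [MeasurableSpace 𝒵] [StandardBorelSpace 𝒵] [Nonempty 𝒵]
    (P : Measure Ω) [IsProbabilityMeasure P] {N : ℕ}
    {κt κr p σ : ℝ} (hκt : 0 ≤ κt) (hκr : 0 ≤ κr) (hp : 0 < p) (hσ : 0 < σ)
    {h hhat : Ω → Fin N → ℂ} (hh : Measurable h) (hhhat : Measurable hhat)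
    (hL2 : ∀ i, MemLp (fun ω => h ω i) 2 P)
    {g : (Fin N → ℂ) → 𝒰} (hg : Measurable g) {Z : Ω → 𝒵} (hZ : Measurable Z)
    {w : (Fin N → ℂ) → (Fin N → ℂ)} (hw : w ∈ Beamformer N) :
    ENNReal.ofReal (Real.logb 2 (1 + effectiveSINR κt κr p σ P h (fun ω => w (hhat ω))))
      ≤ capacity κt κr p σ P h hhat g Z := by
  have hwm : Measurable fun ω => w (hhat ω) := hw.1.comp hhhat
  have hhi : ∀ i, Measurable fun ω => h ω i := fun i => (measurable_pi_apply i).comp hh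
  have hwi : ∀ i, Measurable fun ω => w (hhat ω) i := fun i => (measurable_pi_apply i).comp hwm
  have htm : Measurable fun ω => h ω ⬝ᵥ w (hhat ω) :=
    Finset.measurable_fun_sum _ fun i _ => (hhi i).mul (hwi i)
  have hi : ∀ i, Integrable (fun ω => ‖h ω i‖ ^ 2) P := fun i => (hL2 i).norm.integrable_sq
  have hle : ∀ ω i, ‖w (hhat ω) i‖ ^ 2 ≤ 1 := fun ω i => by
    rw [← hw.2 (hhat ω)]
    exact Finset.single_le_sum (f := fun i => ‖w (hhat ω) i‖ ^ 2)
      (fun _ _ => sq_nonneg _) (Finset.mem_univ i)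
  have hs : ∀ i, Integrable (fun ω => ‖h ω i‖ ^ 2 * ‖w (hhat ω) i‖ ^ 2) P := fun i =>
    (hi i).mono' (((hhi i).norm.pow_const 2).mul ((hwi i).norm.pow_const 2)).aestronglyMeasurable
      (ae_of_all _ fun ω => by
        rw [Real.norm_of_nonneg (by positivity)]
        exact mul_le_of_le_one_right (sq_nonneg _) (hle ω i))
  have ht : MemLp (fun ω => h ω ⬝ᵥ w (hhat ω)) 2 P := by
    rw [memLp_two_iff_integrable_sq_norm htm.aestronglyMeasurable]
    refine (integrable_finsetSum Finset.univ fun i _ => hi i).mono'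
      (htm.norm.pow_const 2).aestronglyMeasurable (ae_of_all _ fun ω => ?_)
    rw [Real.norm_of_nonneg (by positivity)]
    exact norm_dotProduct_sq_le _ _ (hw.2 _)
  set m := ∫ ω, h ω ⬝ᵥ w (hhat ω) ∂P with hmdef
  set T := ∫ ω, ‖h ω ⬝ᵥ w (hhat ω)‖ ^ 2 ∂P with hT
  set S := ∑ i, ∫ ω, ‖h ω i‖ ^ 2 * ‖w (hhat ω) i‖ ^ 2 ∂P with hS
  have hmT : ‖m‖ ^ 2 ≤ T := norm_integral_sq_le ht
  have hT0 : 0 ≤ T := (sq_nonneg _).trans hmT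
  have hS0 : 0 ≤ S := Finset.sum_nonneg fun i _ => integral_nonneg fun ω => by positivity
  -- `D` is `E|y|² / p`.
  set D := (1 + κr) * T + κt * S + σ ^ 2 / p with hD
  have hσp : 0 < σ ^ 2 / p := by positivity
  have hDm : 0 < D - ‖m‖ ^ 2 := by
    have : 0 ≤ κr * T := by positivity
    have : 0 ≤ κt * S := by positivity
    rw [hD]; linarith
  have hD0 : 0 < D := by nlinarith [sq_nonneg ‖m‖]
  have hsinr : 1 + effectiveSINR κt κr p σ P h (fun ω => w (hhat ω)) = D / (D - ‖m‖ ^ 2) := by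
    have : effectiveSINR κt κr p σ P h (fun ω => w (hhat ω)) = ‖m‖ ^ 2 / (D - ‖m‖ ^ 2) := by
      rw [effectiveSINR, ← hmdef, ← hT, ← hS, hD]
      congr 1
      ring
    rw [this]
    field_simp
    ring
  have hτ0 : 0 < p * (D - ‖m‖ ^ 2) / D := by positivity
  -- The LMMSE error, attained by `a = E[s ȳ] / E|y|² = m̄ / D`.
  set τ : ℝ≥0 := (p * (D - ‖m‖ ^ 2) / D).toNNReal with hτdef
  have hτc : (τ : ℝ) = p * (D - ‖m‖ ^ 2) / D := Real.coe_toNNReal _ hτ0.le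
  have hτ : τ ≠ 0 := by simpa [hτdef] using hτ0
  have hτp : τ ≤ p.toNNReal := by
    refine Real.toNNReal_le_toNNReal ?_
    rw [div_le_iff₀ hD0]
    gcongr
    linarith [sq_nonneg ‖m‖]
  have key := log_le_mul_capacity_add_lintegral P σ hκt hκr hp.le hh hhhat hg hZ hw hτ hτp
    ((starRingEnd ℂ) m / D)
  obtain ⟨hint, hval⟩ := integral_estimationError P κt κr p σ p.toNNReal ((starRingEnd ℂ) m / D)
    ht hs
  rw [← ofReal_integral_eq_lintegral_ofReal hint
    (ae_of_all _ fun ω => estimationError_nonneg σ hκt hκr hp.le _ _ _ _), hval, ← hmdef, ← hT,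
    ← hS, Real.coe_toNNReal _ hp.le] at key
  have hre : ((starRingEnd ℂ) m / D * m).re = ‖m‖ ^ 2 / D := by
    rw [div_mul_eq_mul_div, ← Complex.normSq_eq_conj_mul_self, ← Complex.ofReal_div,
      Complex.ofReal_re, Complex.normSq_eq_norm_sq]
  have hna : ‖(starRingEnd ℂ) m / D‖ ^ 2 = ‖m‖ ^ 2 / D ^ 2 := by
    rw [norm_div, RCLike.norm_conj, Complex.norm_real, div_pow, Real.norm_eq_abs, sq_abs]
  have hmse : (1 - 2 * ((starRingEnd ℂ) m / D * m).re + ‖(starRingEnd ℂ) m / D‖ ^ 2 * T) * p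
      + ‖(starRingEnd ℂ) m / D‖ ^ 2 * (κt * p * S + σ ^ 2 + κr * p * T) = τ := by
    have hpD : κt * p * S + σ ^ 2 + κr * p * T = p * (D - T) := by
      rw [hD]; field_simp; ring
    rw [hre, hna, hpD, hτc]
    field_simp
    ring
  have hratio : p / τ = D / (D - ‖m‖ ^ 2) := by
    rw [hτc]; field_simp
  -- The error divided by `τ` is exactly `1` and cancels the `1` on the left.
  rw [hmse, ENNReal.ofReal_coe_nnreal, ENNReal.div_self (by simpa using hτ) (by simp), hratio,
    ← hsinr, ENNReal.add_le_add_iff_right ENNReal.one_ne_top] at key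
  rw [Real.logb, ENNReal.ofReal_div_of_pos (Real.log_pos one_lt_two)]
  exact ENNReal.div_le_of_le_mul' key

end MISO

theorem theorem3 {Ω 𝒰 𝒵 : Type*} [MeasurableSpace Ω] [MeasurableSpace 𝒰]
    [MeasurableSpace 𝒵] [StandardBorelSpace 𝒵] [Nonempty 𝒵]
    (P : Measure Ω) [IsProbabilityMeasure P] {N : ℕ}
    (κt κr p σ : ℝ) (hκt : 0 ≤ κt) (hκr : 0 ≤ κr) (hp : 0 < p) (hσ : 0 < σ)
    (h hhat : Ω → Fin N → ℂ) (hh : Measurable h) (hhhat : Measurable hhat)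
    (R : Matrix (Fin N) (Fin N) ℂ) (hR : MISO.IsComplexGaussian (P.map h) R)
    (g : (Fin N → ℂ) → 𝒰) (hg : Measurable g) (Z : Ω → 𝒵) (hZ : Measurable Z)
    (v : (Fin N → ℂ) → (Fin N → ℂ)) (hv : Measurable v)
    (hv1 : ∀ᵐ ω ∂P, ∑ i, ‖v (hhat ω) i‖ ^ 2 = 1) :
    ENNReal.ofReal (Real.logb 2 (1 + MISO.effectiveSINR κt κr p σ P h (fun ω => v (hhat ω))))
      ≤ MISO.capacity κt κr p σ P h hhat g Z := by
  classical
  obtain ⟨ω₀, hω₀⟩ := hv1.exists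
  -- `Beamformer` asks for unit norm everywhere, so `v` is replaced by one of its own unit values
  -- wherever its norm is not one; the SINR only sees an almost sure class.
  let w : (Fin N → ℂ) → (Fin N → ℂ) := fun x =>
    if ∑ i, ‖v x i‖ ^ 2 = 1 then v x else v (hhat ω₀)
  have hw : w ∈ MISO.Beamformer N := by
    refine ⟨Measurable.ite (measurableSet_eq_fun (by fun_prop) measurable_const) hv
      measurable_const, fun x => ?_⟩
    by_cases hx : ∑ i, ‖v x i‖ ^ 2 = 1 <;> simp [w, hx, hω₀]
  have hwv : ∀ᵐ ω ∂P, w (hhat ω) = v (hhat ω) := by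
    filter_upwards [hv1] with ω hω
    simp [w, hω]
  have e : MISO.effectiveSINR κt κr p σ P h (fun ω => v (hhat ω))
      = MISO.effectiveSINR κt κr p σ P h (fun ω => w (hhat ω)) := by
    have e1 : ∫ ω, h ω ⬝ᵥ v (hhat ω) ∂P = ∫ ω, h ω ⬝ᵥ w (hhat ω) ∂P :=
      integral_congr_ae (hwv.mono fun ω hω => by simp only [hω])
    have e2 : ∫ ω, ‖h ω ⬝ᵥ v (hhat ω)‖ ^ 2 ∂P = ∫ ω, ‖h ω ⬝ᵥ w (hhat ω)‖ ^ 2 ∂P :=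
      integral_congr_ae (hwv.mono fun ω hω => by simp only [hω])
    have e3 : ∀ i, ∫ ω, ‖h ω i‖ ^ 2 * ‖v (hhat ω) i‖ ^ 2 ∂P
        = ∫ ω, ‖h ω i‖ ^ 2 * ‖w (hhat ω) i‖ ^ 2 ∂P := fun i =>
      integral_congr_ae (hwv.mono fun ω hω => by simp only [hω])
    simp only [MISO.effectiveSINR, e1, e2, e3]
  rw [e]
  exact MISO.logb_le_capacity_of_mem_beamformer P hκt hκr hp hσ hh hhhat
    (MISO.IsComplexGaussian.memLp_apply hh hR) hg hZ hw
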